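/- Let $\dot\sigma_b^2>0$ and consider sequences of positive integers $m=m_k\to\infty$ (number of clusters) and $n=n_k\to\infty$ (common cluster size) with $m/n^2\to 0$. For each $k$, observe the balanced Poisson random-intercept model with log link: the clusters $(\dot b_i,y_{i1},\dots,y_{in})$, $i=1,\dots,m$, are independent, $\dot b_i\sim N(0,\dot\sigma_b^2)$, and conditionally on $\dot b_i$ the responses $y_{i1},\dots,y_{in}$ are independent Poisson variables with mean $e^{\dot b_i}$, i.e. with density $f(y\mid \dot b_i)=\exp(y\dot b_i-e^{\dot b_i})/y!$. Let $\hat\sigma_b^2>0$ be a working variance, possibly random and depending on $k$, with $\hat\sigma_b^{-2}=O_p(1)$, and let $\hat b=(\hat b_1,\dots,\hat b_m)$ be the penalized quasi-likelihood estimator, i.e. the maximizer over $b\in\mathbb R^m$ of $$Q(b)=\sum_{i=1}^m\sum_{j=1}^n \ln f(y_{ij}\mid b_i)-\frac12\sum_{i=1}^m \hat\sigma_b^{-2}b_i^2 .$$ Then, unconditionally on the random effects, $$n^{1/2}(\hat b_1-\dot b_1)=n^{-1/2}\sum_{j=1}^n\{y_{1j}e^{-\dot b_1}-1\}+o_p(1).$$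 Moreover, the sum $S_k=n^{-1/2}\sum_{j=1}^n\{y_{1j}e^{-\dot b_1}-1\}$ is not asymptotically normal under any normalization: for no deterministic real sequences $(r_k)$, $(c_k)$ does $r_kS_k+c_k$ converge in distribution to a nondegenerate normal law. The same holds for the prediction gap $\hat b_1-\dot b_1$: for no deterministic real sequences $(r_k)$, $(c_k)$ does $r_k(\hat b_1-\dot b_1)+c_k$ converge in distribution to a nondegenerate normal law. -/

import Mathlib

open MeasureTheory ProbabilityTheory Filter Topology
open scoped ENNReal NNReal

noncomputable section

/-- The Poisson probability mass function on the canonical (log) scale: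
`f(y | η) = exp (y η - exp η) / y!`, i.e. mean `exp η`. -/
def poissonLogLinkDensity (η : ℝ) (y : ℕ) : ℝ :=
  Real.exp ((y : ℝ) * η - Real.exp η) / (y.factorial : ℝ)

/-- The balanced Poisson random-intercept model with log link, `m` clusters of size `n` and
random-effect variance `v`, on the probability space `(Ω, P)`:
the clusters `(b i, y i ·)` are independent, `b i ∼ N(0, v)`, and, conditionally on `b i`,
the responses `y i 1, …, y i n` are independent Poisson variables with mean `exp (b i)`. -/
structure PoissonRandomIntercept {Ω : Type*} [MeasurableSpace Ω] (P : Measure Ω)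
    (m n : ℕ) (v : ℝ≥0) (b : Fin m → Ω → ℝ) (y : Fin m → Fin n → Ω → ℕ) : Prop where
  measurable_effect : ∀ i, Measurable (b i)
  measurable_response : ∀ i j, Measurable (y i j)
  law_effect : ∀ i, HasLaw (b i) (gaussianReal 0 v) P
  /-- Given `b i`, the vector `(y i 1, …, y i n)` has the product Poisson density. -/
  cond_law_response : ∀ (i : Fin m) (A : Set ℝ) (l : Fin n → ℕ), MeasurableSet A →
    P (b i ⁻¹' A ∩ {ω | ∀ j, y i j ω = l j}) =
      ∫⁻ ω in b i ⁻¹' A, ∏ j, ENNReal.ofReal (poissonLogLinkDensity (b i ω) (l j)) ∂P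
  indep_clusters : iIndepFun (fun (i : Fin m) (ω : Ω) => (b i ω, fun j : Fin n => y i j ω)) P

/-- The penalized quasi-likelihood objective of this model, for data `y` and working
random-effect variance `s`:
`Q(β) = ∑ i, ∑ j, log f(y i j | β i) - (1/2) ∑ i, β i * s⁻¹ * β i`. -/
def pqlObjective {m n : ℕ} (y : Fin m → Fin n → ℕ) (s : ℝ) (β : Fin m → ℝ) : ℝ :=
  (∑ i, ∑ j, Real.log (poissonLogLinkDensity (β i) (y i j)))
    - (1 / 2) * ∑ i, β i * s⁻¹ * β i

/-- `β` is a PQL estimate: it maximizes the PQL objective over all vectors of random effects. -/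
def IsPQLEstimate {m n : ℕ} (y : Fin m → Fin n → ℕ) (s : ℝ) (β : Fin m → ℝ) : Prop :=
  IsMaxOn (pqlObjective y s) Set.univ β

/-- `X k = o_p(1)` as `k → ∞`. -/
def IsLittleOpOne {Ω : ℕ → Type*} [∀ k, MeasurableSpace (Ω k)] (P : ∀ k, Measure (Ω k))
    (X : ∀ k, Ω k → ℝ) : Prop :=
  ∀ ε : ℝ, 0 < ε → Tendsto (fun k => P k {ω | ε ≤ |X k ω|}) atTop (𝓝 0)

/-- `X k = O_p(1)` as `k → ∞` (stochastic boundedness). -/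
def IsBigOpOne {Ω : ℕ → Type*} [∀ k, MeasurableSpace (Ω k)] (P : ∀ k, Measure (Ω k))
    (X : ∀ k, Ω k → ℝ) : Prop :=
  ∀ ε : ℝ≥0∞, 0 < ε → ∃ C : ℝ, ∀ᶠ k in atTop, P k {ω | C < |X k ω|} ≤ ε

/-- `X k` is asymptotically normal under some deterministic normalization: there are real
sequences `r` (scale) and `c` (centering) such that `r k * X k + c k` converges in distribution
to a nondegenerate normal law. -/
def IsAsymptoticallyNormal {Ω : ℕ → Type*} [∀ k, MeasurableSpace (Ω k)]
    (P : ∀ k, Measure (Ω k)) [∀ k, IsProbabilityMeasure (P k)] (X : ∀ k, Ω k → ℝ) : Prop :=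
  ∃ (r c : ℕ → ℝ) (μ : ℝ) (w : ℝ≥0), w ≠ 0 ∧
    TendstoInDistribution (fun k ω => r k * X k ω + c k) atTop (id : ℝ → ℝ) P (gaussianReal μ w)

end

/-!
Given the random effect `x`, the conditional scores `y exp (-x) - 1` are i.i.d. with mean `0` and
variance `exp (-x)`, so by the central limit theorem under the conditional law and dominated
convergence of characteristic functions `S` converges to the normal scale mixture
`exp (-b / 2) * N(0, 1)` with `b ∼ N(0, v)` independent of the normal factor. With `Δ` the
prediction gap, the estimating equation of the cluster reads
`√n S = n (exp Δ - 1) + s⁻¹ exp (-b) (b + Δ)`, and linearizing the exponential gives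
`√n Δ = S + o_p(1)`.

Were `S` asymptotically normal under some normalization, convergence of types would force the
modulus of the characteristic function of the limit to be `exp (-τ t ^ 2)`. For a normal scale
mixture with random scale `σ`, the values `t = 1` and `t = √2` then show that `exp (-σ ^ 2 / 2)` has
variance zero, so that `σ ^ 2` is almost surely constant; but `exp (-b)` is not constant when `b`
has no atoms.
-/

section StochasticOrder

variable {Ω : ℕ → Type*} [∀ k, MeasurableSpace (Ω k)] {P : ∀ k, Measure (Ω k)}
  {X Y Z : ∀ k, Ω k → ℝ}

lemma IsBigOpOne.of_abs_le₂ (hX : IsBigOpOne P X) (hY : IsBigOpOne P Y)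
    (h : ∀ C D : ℝ, ∃ K : ℝ, ∀ k ω, |X k ω| ≤ C → |Y k ω| ≤ D → |Z k ω| ≤ K) :
    IsBigOpOne P Z := by
  intro ε hε
  have hε2 : 0 < ε / 2 := ENNReal.half_pos hε.ne'
  obtain ⟨C, hC⟩ := hX _ hε2
  obtain ⟨D, hD⟩ := hY _ hε2
  obtain ⟨K, hK⟩ := h C D
  refine ⟨K, ?_⟩
  filter_upwards [hC, hD] with k hCk hDk
  have hsub : {ω | K < |Z k ω|} ⊆ {ω | C < |X k ω|} ∪ {ω | D < |Y k ω|} := by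
    intro ω hω
    by_contra hout
    simp only [Set.mem_union, Set.mem_ofPred_eq, not_or, not_lt] at hout
    exact (hK k ω hout.1 hout.2).not_gt hω
  calc P k {ω | K < |Z k ω|}
      ≤ P k {ω | C < |X k ω|} + P k {ω | D < |Y k ω|} :=
        (measure_mono hsub).trans (measure_union_le _ _)
    _ ≤ ε / 2 + ε / 2 := add_le_add hCk hDk
    _ = ε := ENNReal.add_halves ε

lemma IsBigOpOne.add (hX : IsBigOpOne P X) (hY : IsBigOpOne P Y) :
    IsBigOpOne P fun k ω => X k ω + Y k ω :=
  hX.of_abs_le₂ hY fun C D => ⟨C + D, fun k ω hC hD =>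
    (abs_add_le (X k ω) (Y k ω)).trans (add_le_add hC hD)⟩

lemma IsBigOpOne.mul (hX : IsBigOpOne P X) (hY : IsBigOpOne P Y) :
    IsBigOpOne P fun k ω => X k ω * Y k ω :=
  hX.of_abs_le₂ hY fun C D => ⟨C * D, fun k ω hC hD => by
    rw [abs_mul]
    exact mul_le_mul hC hD (abs_nonneg _) ((abs_nonneg _).trans hC)⟩

lemma IsBigOpOne.abs (hX : IsBigOpOne P X) : IsBigOpOne P fun k ω => |X k ω| := by
  simpa only [IsBigOpOne, abs_abs] using hX

lemma IsBigOpOne.isLittleOpOne_of_abs_le (hX : IsBigOpOne P X)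
    (h : ∀ C : ℝ, ∃ δ : ℕ → ℝ, Tendsto δ atTop (𝓝 0) ∧
      ∀ᶠ k in atTop, ∀ᵐ ω ∂P k, |X k ω| ≤ C → |Y k ω| ≤ δ k) :
    IsLittleOpOne P Y := by
  intro ε hε
  refine ENNReal.tendsto_nhds_zero.2 fun η hη => ?_
  obtain ⟨C, hC⟩ := hX η hη
  obtain ⟨δ, hδ, hYδ⟩ := h C
  filter_upwards [hC, hYδ, hδ.eventually_lt_const hε] with k hCk hYk hδk
  refine (measure_mono_ae ?_).trans hCk
  filter_upwards [hYk] with ω hω hεω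
  exact not_le.1 fun hXC => ((hω hXC).trans_lt hδk).not_ge hεω

lemma IsBigOpOne.const_mul_isLittleOpOne (hX : IsBigOpOne P X) {δ : ℕ → ℝ}
    (hδ : Tendsto δ atTop (𝓝 0)) : IsLittleOpOne P fun k ω => δ k * X k ω :=
  hX.isLittleOpOne_of_abs_le fun C => ⟨fun k => |δ k| * C, by simpa using hδ.abs.mul_const C,
    .of_forall fun k => .of_forall fun ω hω => by
      rw [abs_mul]
      exact mul_le_mul_of_nonneg_left hω (abs_nonneg _)⟩

variable [∀ k, IsProbabilityMeasure (P k)]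
  {Ω' : Type*} [MeasurableSpace Ω'] {Q : Measure Ω'} [IsProbabilityMeasure Q] {W : Ω' → ℝ}

lemma tendstoInDistribution_iff_tendsto_charFun (hX : ∀ k, AEMeasurable (X k) (P k))
    (hW : AEMeasurable W Q) :
    TendstoInDistribution X atTop W P Q ↔
      ∀ t, Tendsto (fun k => charFun ((P k).map (X k)) t) atTop (𝓝 (charFun (Q.map W) t)) :=
  ⟨fun h => ProbabilityMeasure.tendsto_iff_tendsto_charFun.1 h.tendsto,
    fun h => ⟨hX, hW, ProbabilityMeasure.tendsto_iff_tendsto_charFun.2 h⟩⟩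

lemma tendstoInDistribution_comp_tendsto (h : TendstoInDistribution X atTop W P Q) {φ : ℕ → ℕ}
    (hφ : Tendsto φ atTop atTop) :
    TendstoInDistribution (fun k => X (φ k)) atTop W (fun k => P (φ k)) Q :=
  ⟨fun k => h.forall_aemeasurable (φ k), h.aemeasurable_limit, h.tendsto.comp hφ⟩

lemma isBigOpOne_of_tendstoInDistribution (h : TendstoInDistribution X atTop W P Q) :
    IsBigOpOne P X := by
  have hX := h.forall_aemeasurable
  have hW := h.aemeasurable_limit
  have hlaw (k : ℕ) := Measure.isProbabilityMeasure_map (hX k)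
  have := Measure.isProbabilityMeasure_map hW
  have htight : IsTightMeasureSet (Set.range fun k => (P k).map (X k)) :=
    isTightMeasureSet_of_tendsto_charFun (by fun_prop)
      ((tendstoInDistribution_iff_tendsto_charFun hX hW).1 h)
  intro ε hε
  obtain ⟨C, hC⟩ := (ENNReal.tendsto_nhds_zero.1
    (tendsto_measure_norm_gt_of_isTightMeasureSet htight) ε hε).exists
  refine ⟨C, .of_forall fun k => ?_⟩
  calc P k {ω | C < |X k ω|}
      ≤ (P k).map (X k) {x | C < ‖x‖} := Measure.le_map_apply (hX k) {x | C < ‖x‖}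
    _ ≤ ⨆ μ ∈ Set.range fun k => (P k).map (X k), μ {x | C < ‖x‖} :=
        le_iSup₂ (f := fun (μ : Measure ℝ) _ => μ {x | C < ‖x‖}) _ ⟨k, rfl⟩
    _ ≤ ε := hC

lemma isBigOpOne_of_hasLaw {ρ : Measure ℝ} (hX : ∀ k, HasLaw (X k) ρ (P k)) :
    IsBigOpOne P X :=
  isBigOpOne_of_tendstoInDistribution (tendstoInDistribution_of_identDistrib 0
    (fun k => (hX 0).identDistrib (hX k)) ((hX 0).identDistrib (hX 0)))

lemma tendstoInDistribution_of_map_eq {Ω₂ : ℕ → Type*} [∀ k, MeasurableSpace (Ω₂ k)]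
    {P₂ : ∀ k, Measure (Ω₂ k)} [∀ k, IsProbabilityMeasure (P₂ k)] {X₂ : ∀ k, Ω₂ k → ℝ}
    (h : TendstoInDistribution X atTop W P Q) (hX₂ : ∀ k, AEMeasurable (X₂ k) (P₂ k))
    (hmap : ∀ k, (P₂ k).map (X₂ k) = (P k).map (X k)) :
    TendstoInDistribution X₂ atTop W P₂ Q :=
  ⟨hX₂, h.aemeasurable_limit, h.tendsto.congr fun k => Subtype.ext (hmap k).symm⟩

lemma tendstoInDistribution_comp_eval_infinitePi_iff (hX : ∀ k, AEMeasurable (X k) (P k)) :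
    TendstoInDistribution (fun k (ω : ∀ j, Ω j) => X k (ω k)) atTop W
      (fun _ => Measure.infinitePi P) Q ↔ TendstoInDistribution X atTop W P Q := by
  have heval (k : ℕ) := measurePreserving_eval_infinitePi P k
  have hmap (k : ℕ) : (Measure.infinitePi P).map (fun ω => X k (ω k)) = (P k).map (X k) := by
    rw [← (heval k).map_eq, AEMeasurable.map_map_of_aemeasurable _ (heval k).aemeasurable]
    · rfl
    · rw [(heval k).map_eq]
      exact hX k
  exact ⟨fun h => tendstoInDistribution_of_map_eq h hX fun k => (hmap k).symm,
    fun h => tendstoInDistribution_of_map_eq h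
      (fun k => (hX k).comp_quasiMeasurePreserving (heval k).quasiMeasurePreserving) hmap⟩

-- Realizing both sequences on one space, the product of the `Ω k`, reduces the claim to Slutsky's
-- lemma on a fixed probability space.
lemma tendstoInDistribution_of_isLittleOpOne_sub (hX : TendstoInDistribution X atTop W P Q)
    (hY : ∀ k, AEMeasurable (Y k) (P k)) (hXY : IsLittleOpOne P fun k ω => Y k ω - X k ω) :
    TendstoInDistribution Y atTop W P Q := by
  have heval (k : ℕ) := measurePreserving_eval_infinitePi P k
  have hXmeas := hX.forall_aemeasurable
  rw [← tendstoInDistribution_comp_eval_infinitePi_iff hXmeas] at hX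
  rw [← tendstoInDistribution_comp_eval_infinitePi_iff hY]
  refine tendstoInDistribution_of_tendstoInMeasure_sub _ W hX ?_
    fun k => (hY k).comp_quasiMeasurePreserving (heval k).quasiMeasurePreserving
  refine tendstoInMeasure_iff_norm.2 fun ε hε => (hXY ε hε).congr fun k => ?_
  have hnull : NullMeasurableSet {ω | ε ≤ |Y k ω - X k ω|} (P k) :=
    nullMeasurableSet_le aemeasurable_const ((hY k).sub (hXmeas k)).abs
  rw [← (heval k).measure_preimage hnull]
  simp [Set.preimage]

lemma tendstoInDistribution_mul_of_tendsto (hX : TendstoInDistribution X atTop W P Q)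
    {a : ℕ → ℝ} {c : ℝ} (ha : Tendsto a atTop (𝓝 c)) :
    TendstoInDistribution (fun k ω => a k * X k ω) atTop (fun ω => c * W ω) P Q := by
  have hdiff : IsLittleOpOne P fun k ω => a k * X k ω - c * X k ω := by
    simp only [← sub_mul]
    exact (isBigOpOne_of_tendstoInDistribution hX).const_mul_isLittleOpOne
      (by simpa using ha.sub_const c)
  exact tendstoInDistribution_of_isLittleOpOne_sub (hX.continuous_comp (continuous_const_mul c))
    (fun k => (hX.forall_aemeasurable k).const_mul (a k)) hdiff

end StochasticOrder

section Normalization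

lemma norm_charFun_map_add_const {Ω : Type*} [MeasurableSpace Ω] {P : Measure Ω}
    {X : Ω → ℝ} (hX : AEMeasurable X P) (c t : ℝ) :
    ‖charFun (P.map fun ω => X ω + c) t‖ = ‖charFun (P.map X) t‖ := by
  have hcomp : P.map (fun ω => X ω + c) = (P.map X).map (· + c) :=
    (AEMeasurable.map_map_of_aemeasurable (g := (· + c)) (by fun_prop) hX).symm
  rw [hcomp, charFun_map_add_const, norm_mul, Complex.norm_exp_ofReal_mul_I, mul_one]

variable {Ω : ℕ → Type*} [∀ k, MeasurableSpace (Ω k)] {P : ∀ k, Measure (Ω k)}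
  [∀ k, IsProbabilityMeasure (P k)] {X : ∀ k, Ω k → ℝ}
  {Ω₁ Ω₂ : Type*} [MeasurableSpace Ω₁] [MeasurableSpace Ω₂] {Q₁ : Measure Ω₁} {Q₂ : Measure Ω₂}
  [IsProbabilityMeasure Q₁] [IsProbabilityMeasure Q₂] {Z : Ω₁ → ℝ} {W : Ω₂ → ℝ}

lemma exists_subseq_tendsto_mul_prod_ne_zero (r : ℕ → ℝ) :
    ∃ (u : ℕ → ℝ) (φ : ℕ → ℕ) (a d : ℝ), (a, d) ≠ 0 ∧ Tendsto φ atTop atTop ∧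
      Tendsto (fun k => u (φ k) * r (φ k)) atTop (𝓝 a) ∧
      Tendsto (fun k => u (φ k)) atTop (𝓝 d) := by
  let p : ℕ → ℝ × ℝ := fun k => ‖(r k, (1 : ℝ))‖⁻¹ • (r k, 1)
  have hp (k : ℕ) : p k ∈ Metric.sphere (0 : ℝ × ℝ) 1 := by
    rw [mem_sphere_zero_iff_norm]
    exact norm_smul_inv_norm (𝕜 := ℝ) fun h => one_ne_zero (congrArg Prod.snd h)
  obtain ⟨q, hq, φ, hφ, hlim⟩ := (isCompact_sphere (0 : ℝ × ℝ) 1).tendsto_subseq hp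
  refine ⟨fun k => ‖(r k, (1 : ℝ))‖⁻¹, φ, q.1, q.2, ?_, hφ.tendsto_atTop,
    (continuous_fst.tendsto q).comp hlim, ?_⟩
  · exact Metric.ne_of_mem_sphere hq one_ne_zero
  · simpa [p, Function.comp_def] using (continuous_snd.tendsto q).comp hlim

-- The type of a limit law is determined up to scale and location. Comparing moduli of
-- characteristic functions discards the location, so the centering `c` need not converge.
lemma exists_norm_charFun_eq_of_tendstoInDistribution_affine {r c : ℕ → ℝ}
    (hX : TendstoInDistribution X atTop Z P Q₁)
    (hrX : TendstoInDistribution (fun k ω => r k * X k ω + c k) atTop W P Q₂) :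
    ∃ a d : ℝ, (a, d) ≠ 0 ∧
      ∀ t, ‖charFun (Q₂.map W) (d * t)‖ = ‖charFun (Q₁.map Z) (a * t)‖ := by
  obtain ⟨u, φ, a, d, had, hφ, ha, hd⟩ := exists_subseq_tendsto_mul_prod_ne_zero r
  refine ⟨a, d, had, fun t => ?_⟩
  have hlim₁ := tendstoInDistribution_mul_of_tendsto (tendstoInDistribution_comp_tendsto hX hφ) ha
  have hlim₂ := tendstoInDistribution_mul_of_tendsto (tendstoInDistribution_comp_tendsto hrX hφ) hd
  have hcharFun₁ := ((tendstoInDistribution_iff_tendsto_charFun hlim₁.forall_aemeasurable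
    hlim₁.aemeasurable_limit).1 hlim₁ t).norm
  have hcharFun₂ := ((tendstoInDistribution_iff_tendsto_charFun hlim₂.forall_aemeasurable
    hlim₂.aemeasurable_limit).1 hlim₂ t).norm
  rw [charFun_map_mul_comp hX.aemeasurable_limit] at hcharFun₁
  rw [charFun_map_mul_comp hrX.aemeasurable_limit] at hcharFun₂
  refine tendsto_nhds_unique (hcharFun₂.congr fun k => ?_) hcharFun₁
  have hdistrib : (fun ω => u (φ k) * (r (φ k) * X (φ k) ω + c (φ k))) =
      fun ω => u (φ k) * r (φ k) * X (φ k) ω + u (φ k) * c (φ k) := by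
    funext ω
    ring
  rw [hdistrib, norm_charFun_map_add_const (hlim₁.forall_aemeasurable k)]

lemma norm_charFun_gaussianReal (μ : ℝ) (w : ℝ≥0) (t : ℝ) :
    ‖charFun (gaussianReal μ w) t‖ = Real.exp (-(w * t ^ 2 / 2)) := by
  rw [charFun_gaussianReal, Complex.norm_exp]
  simp [← Complex.ofReal_pow, ← Complex.ofReal_mul]

lemma IsAsymptoticallyNormal.exists_norm_charFun_eq (h : IsAsymptoticallyNormal P X)
    (hX : TendstoInDistribution X atTop Z P Q₁) :
    ∃ τ : ℝ, ∀ t, ‖charFun (Q₁.map Z) t‖ = Real.exp (-(τ * t ^ 2)) := by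
  obtain ⟨r, c, μ, w, hw, hrX⟩ := h
  obtain ⟨a, d, had, hcharFun⟩ := exists_norm_charFun_eq_of_tendstoInDistribution_affine hX hrX
  simp only [Measure.map_id, norm_charFun_gaussianReal] at hcharFun
  have ha : a ≠ 0 := by
    rintro rfl
    have hd : d ≠ 0 := by rintro rfl; exact had rfl
    have := Measure.isProbabilityMeasure_map hX.aemeasurable_limit
    have hexp : Real.exp (-(w * d ^ 2 / 2)) = 1 := by simpa using hcharFun 1
    have hpos : 0 < (w : ℝ) * d ^ 2 / 2 := by positivity
    linarith [Real.exp_eq_one_iff _ |>.1 hexp]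
  refine ⟨w * (d / a) ^ 2 / 2, fun t => ?_⟩
  have ht := hcharFun (t / a)
  rw [mul_div_cancel₀ t ha] at ht
  rw [← ht]
  congr 1
  ring

lemma IsAsymptoticallyNormal.const_mul {a : ℕ → ℝ} (ha : ∀ᶠ k in atTop, a k ≠ 0)
    (hX : ∀ k, AEMeasurable (X k) (P k)) (h : IsAsymptoticallyNormal P X) :
    IsAsymptoticallyNormal P fun k ω => a k * X k ω := by
  obtain ⟨r, c, μ, w, hw, hrX⟩ := h
  refine ⟨fun k => r k / a k, c, μ, w, hw, fun k => by fun_prop, by fun_prop, ?_⟩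
  refine hrX.tendsto.congr' (ha.mono fun k hk => Subtype.ext ?_)
  simp [← mul_assoc, hk]

end Normalization

section NormalScaleMixture

variable {α β : Type*} [MeasurableSpace α] [MeasurableSpace β] {ρ : Measure α} {σ : α → ℝ}

lemma charFun_map_eq_integral {P : Measure α} {X : α → ℝ} (hX : AEMeasurable X P) (t : ℝ) :
    charFun (P.map X) t = ∫ x, Complex.exp (t * X x * Complex.I) ∂P := by
  rw [charFun_apply_real, integral_map hX (by fun_prop)]

section Kernel

variable {κ : Kernel α β} {g : α × β → ℝ}

lemma charFun_compProd_map [IsFiniteMeasure ρ] [IsFiniteKernel κ] (hg : Measurable g) (t : ℝ) :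
    charFun ((ρ ⊗ₘ κ).map g) t = ∫ x, charFun ((κ x).map fun y => g (x, y)) t ∂ρ := by
  have hint : Integrable (fun p => Complex.exp (t * g p * Complex.I)) (ρ ⊗ₘ κ) := by
    refine (integrable_const (1 : ℝ)).mono' (by fun_prop) (.of_forall fun p => ?_)
    rw [← Complex.ofReal_mul, Complex.norm_exp_ofReal_mul_I]
  rw [charFun_map_eq_integral hg.aemeasurable, Measure.integral_compProd hint]
  exact integral_congr_ae (.of_forall fun x => (charFun_map_eq_integral (by fun_prop) t).symm)

lemma stronglyMeasurable_charFun_kernel_map [IsSFiniteKernel κ] (hg : Measurable g) (t : ℝ) :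
    StronglyMeasurable fun x => charFun ((κ x).map fun y => g (x, y)) t := by
  have hcharFun (x : α) : charFun ((κ x).map fun y => g (x, y)) t =
      ∫ y, Complex.exp (t * g (x, y) * Complex.I) ∂κ x :=
    charFun_map_eq_integral (by fun_prop) t
  simp only [hcharFun]
  exact StronglyMeasurable.integral_kernel_prod_right
    (f := fun x y => Complex.exp (t * g (x, y) * Complex.I)) (by fun_prop)

end Kernel

lemma charFun_prod_gaussianReal_map_mul [IsFiniteMeasure ρ] (hσ : Measurable σ) (t : ℝ) :
    charFun ((ρ.prod (gaussianReal 0 1)).map fun p => σ p.1 * p.2) t =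
      ∫ x, charFun (gaussianReal 0 1) (t * σ x) ∂ρ := by
  rw [← Measure.compProd_const, charFun_compProd_map (by fun_prop)]
  refine integral_congr_ae (.of_forall fun x => ?_)
  simpa [mul_comm] using charFun_map_mul_comp (μ := gaussianReal 0 1) aemeasurable_id (σ x) t

lemma exists_ae_sq_eq_of_norm_charFun_normal_mixture [IsProbabilityMeasure ρ] (hσ : Measurable σ)
    {τ : ℝ}
    (h : ∀ t, ‖charFun ((ρ.prod (gaussianReal 0 1)).map fun p => σ p.1 * p.2) t‖ =
      Real.exp (-(τ * t ^ 2))) :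
    ∃ κ, ∀ᵐ x ∂ρ, σ x ^ 2 = κ := by
  have hint (t : ℝ) : ∫ x, Real.exp (-(t * σ x) ^ 2 / 2) ∂ρ = Real.exp (-(τ * t ^ 2)) := by
    have hreal (x : α) : charFun (gaussianReal 0 1) (t * σ x) =
        (Real.exp (-(t * σ x) ^ 2 / 2) : ℝ) := by
      simp [charFun_gaussianReal, neg_div]
    simp only [← h t, charFun_prod_gaussianReal_map_mul hσ, hreal]
    rw [integral_complex_ofReal, Complex.norm_of_nonneg]
    exact integral_nonneg fun x => (Real.exp_pos _).le
  let g : α → ℝ := fun x => Real.exp (-σ x ^ 2 / 2)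
  have hg : MemLp g 2 ρ := by
    refine MemLp.of_bound (by fun_prop) 1 (.of_forall fun x => ?_)
    rw [Real.norm_eq_abs, Real.abs_exp, Real.exp_le_one_iff]
    nlinarith [sq_nonneg (σ x)]
  have hmean : ∫ x, g x ∂ρ = Real.exp (-τ) := by simpa using hint 1
  have hsq : ∫ x, (g ^ 2) x ∂ρ = Real.exp (-τ) ^ 2 := by
    have hexp := hint √2
    simp only [mul_pow, Nat.ofNat_nonneg, Real.sq_sqrt] at hexp
    rw [← Real.exp_nat_mul]
    convert hexp using 2
    · funext x
      simp only [g, Pi.pow_apply, ← Real.exp_nat_mul]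
      congr 1
      push_cast
      ring
    · push_cast
      ring
  have hvar : Var[g; ρ] = 0 := by rw [variance_eq_sub hg, hsq, hmean, sub_self]
  refine ⟨-2 * Real.log (∫ x, g x ∂ρ), ?_⟩
  filter_upwards [ae_eq_integral_of_variance_eq_zero hg hvar] with x hx
  rw [← hx, Real.log_exp]
  ring

end NormalScaleMixture

section MixedCentralLimit

lemma tendsto_charFun_inv_sqrt_mul_pow_of_variance {Ω : Type*} [MeasurableSpace Ω]
    {P : Measure Ω} [IsProbabilityMeasure P] {X : Ω → ℝ} (hX : MemLp X 2 P) (hmean : P[X] = 0)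
    {σ : ℝ} (hvar : Var[X; P] = σ ^ 2) (t : ℝ) :
    Tendsto (fun n : ℕ => charFun (P.map X) ((√n)⁻¹ * t) ^ n) atTop
      (𝓝 (charFun (gaussianReal 0 1) (t * σ))) := by
  have hXmeas : AEMeasurable X P := hX.aemeasurable
  rcases eq_or_ne σ 0 with rfl | hσ
  · have hzero : X =ᵐ[P] fun _ => P[X] :=
      ae_eq_integral_of_variance_eq_zero hX (by simpa using hvar)
    simp [Measure.map_congr hzero, hmean]
  · have hsq : P[(fun ω => X ω / σ) ^ 2] = 1 := by
      rw [variance_of_integral_eq_zero hXmeas hmean] at hvar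
      simp only [Pi.pow_apply, div_pow]
      rw [integral_div, hvar, div_self (pow_ne_zero 2 hσ)]
    have hlim := tendsto_charFun_inv_sqrt_mul_pow (P := P) (X := fun ω => X ω / σ)
      (hXmeas.div_const σ) (by rw [integral_div, hmean, zero_div]) hsq (t * σ)
    have hscale (n : ℕ) : charFun (P.map fun ω => X ω / σ) ((√n)⁻¹ * (t * σ)) =
        charFun (P.map X) ((√n)⁻¹ * t) := by
      simp only [div_eq_inv_mul]
      rw [charFun_map_mul_comp hXmeas]
      congr 1
      field_simp
    simpa [hscale, charFun_gaussianReal, neg_div] using hlim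

lemma charFun_pi_map_mul_sum {β : Type*} [MeasurableSpace β] {μ : Measure β}
    [IsProbabilityMeasure μ] {f : β → ℝ} (hf : Measurable f) {ι : Type*} [Fintype ι] (a t : ℝ) :
    charFun ((Measure.pi fun _ : ι => μ).map fun l => a * ∑ j, f (l j)) t =
      charFun (μ.map f) (a * t) ^ Fintype.card ι := by
  have := Measure.isProbabilityMeasure_map (μ := μ) hf.aemeasurable
  have hmap : (Measure.pi fun _ : ι => μ).map (fun l => ∑ j, f (l j)) =
      (Measure.pi fun _ : ι => μ.map f).map (fun p => ∑ j, p j) := by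
    rw [← Measure.pi_map_pi fun _ => hf.aemeasurable,
      Measure.map_map (by fun_prop) (by fun_prop)]
    rfl
  rw [charFun_map_mul_comp (Measurable.aemeasurable (by fun_prop)), hmap,
    charFun_map_sum_pi_eq_prod]
  simp

variable {α β : Type*} [MeasurableSpace α] [MeasurableSpace β]

/-- The kernel sampling, given `x`, a family of independent variables indexed by `ι` with common
law `κ x`. -/
noncomputable def iidKernel (κ : Kernel α β) [IsMarkovKernel κ] (ι : Type*) [Fintype ι] :
    Kernel α (ι → β) where
  toFun x := Measure.pi fun _ => κ x
  measurable' := by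
    refine Measurable.measure_of_isPiSystem_of_isProbabilityMeasure generateFrom_pi.symm
      isPiSystem_pi ?_
    rintro _ ⟨s, hs, rfl⟩
    simp only [Measure.pi_pi]
    exact Finset.measurable_prod _ fun j _ => κ.measurable_coe (hs j (Set.mem_univ j))

variable {κ : Kernel α β} [IsMarkovKernel κ]

lemma iidKernel_apply (ι : Type*) [Fintype ι] (x : α) :
    iidKernel κ ι x = Measure.pi fun _ => κ x := rfl

instance (ι : Type*) [Fintype ι] : IsMarkovKernel (iidKernel κ ι) :=
  ⟨fun x => by rw [iidKernel_apply]; infer_instance⟩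

lemma tendstoInDistribution_normal_mixture {ρ : Measure α} [IsProbabilityMeasure ρ]
    {f : α → β → ℝ} {σ : α → ℝ} (hf : Measurable (Function.uncurry f)) (hσ : Measurable σ)
    (hf₂ : ∀ x, MemLp (f x) 2 (κ x)) (hmean : ∀ x, (κ x)[f x] = 0)
    (hvar : ∀ x, Var[f x; κ x] = σ x ^ 2) :
    TendstoInDistribution
      (fun (n : ℕ) (p : α × (Fin n → β)) => (√n)⁻¹ * ∑ j, f p.1 (p.2 j)) atTop
      (fun p : α × ℝ => σ p.1 * p.2)
      (fun n => ρ ⊗ₘ iidKernel κ (Fin n)) (ρ.prod (gaussianReal 0 1)) := by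
  have hfmeas (x : α) : Measurable (f x) := hf.of_uncurry_left
  have hsum (n : ℕ) :
      Measurable fun p : α × (Fin n → β) => (√n)⁻¹ * ∑ j, f p.1 (p.2 j) := by
    fun_prop
  rw [tendstoInDistribution_iff_tendsto_charFun (fun n => (hsum n).aemeasurable) (by fun_prop)]
  intro t
  have hcond (n : ℕ) : charFun ((ρ ⊗ₘ iidKernel κ (Fin n)).map
      fun p => (√n)⁻¹ * ∑ j, f p.1 (p.2 j)) t =
      ∫ x, charFun ((κ x).map (f x)) ((√n)⁻¹ * t) ^ n ∂ρ := by
    rw [charFun_compProd_map (hsum n)]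
    simp only [iidKernel_apply, charFun_pi_map_mul_sum (hfmeas _), Fintype.card_fin]
  simp only [hcond, charFun_prod_gaussianReal_map_mul hσ]
  refine tendsto_integral_of_dominated_convergence (fun _ => 1) (fun n => ?_)
    (integrable_const 1) (fun n => .of_forall fun x => ?_) (.of_forall fun x =>
      tendsto_charFun_inv_sqrt_mul_pow_of_variance (hf₂ x) (hmean x) (hvar x) t)
  · exact ((stronglyMeasurable_charFun_kernel_map hf _).pow n).aestronglyMeasurable
  · have := Measure.isProbabilityMeasure_map (μ := κ x) (hfmeas x).aemeasurable
    rw [norm_pow]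
    exact pow_le_one₀ (norm_nonneg _) (norm_charFun_le_one _)

end MixedCentralLimit

section PoissonMoments

open scoped Nat

variable (r : ℝ≥0)

lemma poissonMeasure_weight_succ_mul (k : ℕ) :
    Real.exp (-r) * r ^ (k + 1) / (k + 1)! * (k + 1 : ℕ) = r * (Real.exp (-r) * r ^ k / k !) := by
  rw [Nat.factorial_succ]
  push_cast
  field_simp
  ring

lemma integral_natCast_mul_poissonMeasure (f : ℕ → ℝ) :
    ∫ k, k * f k ∂poissonMeasure r = r * ∫ k, f (k + 1) ∂poissonMeasure r := by
  simp only [integral_poissonMeasure, smul_eq_mul, ← mul_assoc]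
  rw [← tsum_mul_left, ← Nat.succ_injective.tsum_eq]
  · refine tsum_congr fun k => ?_
    rw [Nat.succ_eq_add_one, poissonMeasure_weight_succ_mul, mul_assoc]
  · rintro (_ | k) hk
    · simp at hk
    · exact ⟨k, rfl⟩

variable {r} in
lemma integrable_natCast_mul_poissonMeasure {f : ℕ → ℝ}
    (hf : Integrable (fun k => f (k + 1)) (poissonMeasure r)) :
    Integrable (fun k => k * f k) (poissonMeasure r) := by
  rw [integrable_poissonMeasure_iff] at hf ⊢
  rw [← summable_nat_add_iff 1]
  refine (hf.mul_left (r : ℝ)).congr fun k => ?_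
  rw [norm_mul, Real.norm_natCast, ← mul_assoc, ← mul_assoc, poissonMeasure_weight_succ_mul]

lemma integrable_natCast_poissonMeasure :
    Integrable (fun k : ℕ => (k : ℝ)) (poissonMeasure r) := by
  simpa using integrable_natCast_mul_poissonMeasure (r := r) (f := fun _ => 1) (by simp)

lemma integral_natCast_poissonMeasure : ∫ k, (k : ℝ) ∂poissonMeasure r = r := by
  simpa using integral_natCast_mul_poissonMeasure r fun _ => 1

lemma memLp_two_natCast_poissonMeasure :
    MemLp (fun k : ℕ => (k : ℝ)) 2 (poissonMeasure r) := by
  refine (memLp_two_iff_integrable_sq (Measurable.of_discrete.aestronglyMeasurable)).2 ?_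
  simp only [sq]
  refine integrable_natCast_mul_poissonMeasure ?_
  simpa using (integrable_natCast_poissonMeasure r).add (integrable_const (1 : ℝ))

lemma variance_natCast_poissonMeasure :
    Var[fun k : ℕ => (k : ℝ); poissonMeasure r] = r := by
  have hsq : ∫ k, (k : ℝ) * k ∂poissonMeasure r = r * (r + 1) := by
    rw [integral_natCast_mul_poissonMeasure]
    simp [integral_add (integrable_natCast_poissonMeasure r) (integrable_const (1 : ℝ)),
      integral_natCast_poissonMeasure]
  rw [variance_eq_sub (memLp_two_natCast_poissonMeasure r), integral_natCast_poissonMeasure]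
  simp only [Pi.pow_apply, sq, hsq]
  ring

lemma measurable_poissonMeasure : Measurable poissonMeasure := by
  refine Measure.measurable_of_measurable_coe _ fun s hs => ?_
  simp only [poissonMeasure, Measure.sum_apply _ hs, Measure.smul_apply, smul_eq_mul]
  fun_prop

end PoissonMoments

section ClusterLaw

lemma measure_prod_ext_singleton {α β : Type*} [MeasurableSpace α] [MeasurableSpace β]
    [Countable β] [MeasurableSingletonClass β] {μ ν : Measure (α × β)} [IsFiniteMeasure μ]
    (h : ∀ A l, MeasurableSet A → μ (A ×ˢ {l}) = ν (A ×ˢ {l})) : μ = ν := by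
  refine Measure.ext_prod_iff.2 fun {A D} hA hD => ?_
  have hslice (κ : Measure (α × β)) {E : Set β} (hE : MeasurableSet E) :
      (κ.restrict (A ×ˢ Set.univ)).map Prod.snd E = κ (A ×ˢ E) := by
    rw [Measure.map_apply measurable_snd hE, Measure.restrict_apply (measurable_snd hE),
      ← Set.univ_prod, Set.prod_inter_prod, Set.univ_inter, Set.inter_univ]
  have hmap : (μ.restrict (A ×ˢ Set.univ)).map Prod.snd =
      (ν.restrict (A ×ˢ Set.univ)).map Prod.snd :=
    Measure.ext_of_singleton fun l => by
      rw [hslice μ (measurableSet_singleton l), hslice ν (measurableSet_singleton l), h A l hA]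
  rw [← hslice μ hD, ← hslice ν hD, hmap]

/-- The conditional law of one response given its random effect `x`: Poisson with mean `exp x`. -/
noncomputable def poissonLogLinkKernel : Kernel ℝ ℕ where
  toFun x := poissonMeasure (Real.exp x).toNNReal
  measurable' := measurable_poissonMeasure.comp (by fun_prop)

lemma poissonLogLinkKernel_apply (x : ℝ) :
    poissonLogLinkKernel x = poissonMeasure (Real.exp x).toNNReal := rfl

instance : IsMarkovKernel poissonLogLinkKernel :=
  ⟨fun x => by rw [poissonLogLinkKernel_apply]; infer_instance⟩

lemma poissonLogLinkKernel_singleton (x : ℝ) (k : ℕ) :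
    poissonLogLinkKernel x {k} = ENNReal.ofReal (poissonLogLinkDensity x k) := by
  rw [poissonLogLinkKernel_apply, poissonMeasure_singleton,
    Real.coe_toNNReal _ (Real.exp_nonneg x), poissonLogLinkDensity, Real.exp_sub, Real.exp_neg,
    Real.exp_nat_mul, div_eq_inv_mul (Real.exp x ^ k)]

lemma PoissonRandomIntercept.map_cluster {Ω : Type*} [MeasurableSpace Ω] {P : Measure Ω}
    [IsProbabilityMeasure P] {m n : ℕ} {v : ℝ≥0} {b : Fin m → Ω → ℝ}
    {y : Fin m → Fin n → Ω → ℕ} (h : PoissonRandomIntercept P m n v b y) (i : Fin m) :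
    P.map (fun ω => (b i ω, fun j => y i j ω)) =
      gaussianReal 0 v ⊗ₘ iidKernel poissonLogLinkKernel (Fin n) := by
  have hb := h.measurable_effect i
  have hy : Measurable fun ω j => y i j ω := measurable_pi_lambda _ (h.measurable_response i)
  refine measure_prod_ext_singleton fun A l hA => ?_
  have hpreimage : (fun ω => (b i ω, fun j => y i j ω)) ⁻¹' A ×ˢ {l} =
      b i ⁻¹' A ∩ {ω | ∀ j, y i j ω = l j} := by
    ext ω
    simp [funext_iff]
  rw [Measure.map_apply (hb.prodMk hy) (hA.prod (measurableSet_singleton l)), hpreimage,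
    h.cond_law_response i A l hA, Measure.compProd_apply_prod hA (measurableSet_singleton l),
    ← (h.law_effect i).map_eq,
    setLIntegral_map hA (Kernel.measurable_coe _ (measurableSet_singleton l)) hb]
  simp only [iidKernel_apply, Measure.pi_singleton, poissonLogLinkKernel_singleton]

lemma integral_poissonLogLinkKernel_score (x : ℝ) :
    ∫ k, (k * Real.exp (-x) - 1) ∂poissonLogLinkKernel x = 0 := by
  rw [poissonLogLinkKernel_apply, integral_sub
    ((integrable_natCast_poissonMeasure _).mul_const _) (integrable_const _), integral_mul_const,
    integral_natCast_poissonMeasure, Real.coe_toNNReal _ (Real.exp_nonneg x), ← Real.exp_add]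
  simp

lemma memLp_two_poissonLogLinkKernel_score (x : ℝ) :
    MemLp (fun k : ℕ => k * Real.exp (-x) - 1) 2 (poissonLogLinkKernel x) :=
  ((memLp_two_natCast_poissonMeasure _).mul_const _).sub (memLp_const 1)

lemma variance_poissonLogLinkKernel_score (x : ℝ) :
    Var[fun k : ℕ => k * Real.exp (-x) - 1; poissonLogLinkKernel x] = Real.exp (-x / 2) ^ 2 := by
  rw [poissonLogLinkKernel_apply, variance_sub_const .of_discrete, variance_mul_const,
    variance_natCast_poissonMeasure, Real.coe_toNNReal _ (Real.exp_nonneg x), ← Real.exp_nat_mul,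
    ← Real.exp_nat_mul, ← Real.exp_add]
  congr 1
  push_cast
  ring

end ClusterLaw

section StandardizedScore

/-- The leading term of the prediction gap of a cluster with random effect `x` and responses `l`:
the sum of the conditional scores `l j * exp (-x) - 1`, standardized by the square root of the
cluster size. -/
noncomputable def standardizedScore {n : ℕ} (x : ℝ) (l : Fin n → ℕ) : ℝ :=
  (√(n : ℝ))⁻¹ * ∑ j, ((l j : ℝ) * Real.exp (-x) - 1)

lemma measurable_standardizedScore (n : ℕ) :
    Measurable fun p : ℝ × (Fin n → ℕ) => standardizedScore p.1 p.2 := by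
  unfold standardizedScore
  fun_prop

variable {Ω : ℕ → Type*} [∀ k, MeasurableSpace (Ω k)] {P : ∀ k, Measure (Ω k)}
  [∀ k, IsProbabilityMeasure (P k)]

lemma PoissonRandomIntercept.tendstoInDistribution_standardizedScore {m n : ℕ → ℕ} {v : ℝ≥0}
    {b : ∀ k, Fin (m k) → Ω k → ℝ} {y : ∀ k, Fin (m k) → Fin (n k) → Ω k → ℕ}
    (h : ∀ k, PoissonRandomIntercept (P k) (m k) (n k) v (b k) (y k))
    (hn : Tendsto n atTop atTop) (i : ∀ k, Fin (m k)) :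
    TendstoInDistribution (fun k ω => standardizedScore (b k (i k) ω) fun j => y k (i k) j ω)
      atTop (fun p : ℝ × ℝ => Real.exp (-p.1 / 2) * p.2) P
      ((gaussianReal 0 v).prod (gaussianReal 0 1)) := by
  have hlim := tendstoInDistribution_comp_tendsto (tendstoInDistribution_normal_mixture
    (ρ := gaussianReal 0 v) (f := fun x (l : ℕ) => (l : ℝ) * Real.exp (-x) - 1)
    (σ := fun x => Real.exp (-x / 2)) (by fun_prop) (by fun_prop)
    memLp_two_poissonLogLinkKernel_score integral_poissonLogLinkKernel_score
    variance_poissonLogLinkKernel_score) hn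
  have hcluster (k : ℕ) : Measurable fun ω => (b k (i k) ω, fun j => y k (i k) j ω) :=
    ((h k).measurable_effect (i k)).prodMk
      (measurable_pi_lambda _ ((h k).measurable_response (i k)))
  refine tendstoInDistribution_of_map_eq hlim
    (fun k => ((measurable_standardizedScore _).comp (hcluster k)).aemeasurable) fun k => ?_
  rw [← (h k).map_cluster (i k)]
  exact (Measure.map_map (measurable_standardizedScore _) (hcluster k)).symm

lemma not_ae_exp_neg_half_sq_eq_const {v : ℝ≥0} (hv : v ≠ 0) (κ : ℝ) :
    ¬ ∀ᵐ x ∂gaussianReal 0 v, Real.exp (-x / 2) ^ 2 = κ := by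
  intro hκ
  have := nullSingletonClass_gaussianReal (μ := 0) hv
  obtain ⟨x, hx, hxne⟩ := (hκ.and (Measure.ae_ne (gaussianReal 0 v) (-Real.log κ))).exists
  refine hxne ?_
  rw [← hx, ← Real.exp_nat_mul, Real.log_exp]
  push_cast
  ring

variable {X : ∀ k, Ω k → ℝ}

lemma not_isAsymptoticallyNormal_of_tendstoInDistribution_lognormal_mixture {v : ℝ≥0} (hv : v ≠ 0)
    (hX : TendstoInDistribution X atTop (fun p : ℝ × ℝ => Real.exp (-p.1 / 2) * p.2) P
      ((gaussianReal 0 v).prod (gaussianReal 0 1))) :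
    ¬ IsAsymptoticallyNormal P X := by
  intro hnormal
  obtain ⟨τ, hτ⟩ := hnormal.exists_norm_charFun_eq hX
  obtain ⟨κ, hκ⟩ := exists_ae_sq_eq_of_norm_charFun_normal_mixture
    (σ := fun x => Real.exp (-x / 2)) (by fun_prop) hτ
  exact not_ae_exp_neg_half_sq_eq_const hv κ hκ

end StandardizedScore

section PenalizedQuasiLikelihood

lemma log_poissonLogLinkDensity (η : ℝ) (k : ℕ) :
    Real.log (poissonLogLinkDensity η k) = k * η - Real.exp η - Real.log k.factorial := by
  rw [poissonLogLinkDensity, Real.log_div (Real.exp_pos _).ne' (by positivity), Real.log_exp]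

variable {m n : ℕ} {y : Fin m → Fin n → ℕ} {s : ℝ} {β : Fin m → ℝ}

lemma pqlObjective_update_sub (i : Fin m) (t : ℝ) :
    pqlObjective y s (Function.update β i t) - pqlObjective y s β =
      (∑ j, Real.log (poissonLogLinkDensity t (y i j)) - 1 / 2 * (t * s⁻¹ * t)) -
        (∑ j, Real.log (poissonLogLinkDensity (β i) (y i j)) - 1 / 2 * (β i * s⁻¹ * β i)) := by
  simp only [pqlObjective, Finset.mul_sum, ← Finset.sum_sub_distrib]
  rw [Finset.sum_eq_single i]
  · simp
  · intro j _ hj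
    simp [hj]
  · simp

lemma hasDerivAt_sum_log_poissonLogLinkDensity_sub_penalty (l : Fin n → ℕ) (s t : ℝ) :
    HasDerivAt
      (fun t => ∑ j, Real.log (poissonLogLinkDensity t (l j)) - 1 / 2 * (t * s⁻¹ * t))
      (∑ j, ((l j : ℝ) - Real.exp t) - s⁻¹ * t) t := by
  have hlik : HasDerivAt (fun t => ∑ j, Real.log (poissonLogLinkDensity t (l j)))
      (∑ j, ((l j : ℝ) - Real.exp t)) t := by
    simp only [log_poissonLogLinkDensity]
    refine HasDerivAt.fun_sum fun j _ => ?_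
    simpa using (((hasDerivAt_id t).const_mul (l j : ℝ)).sub
      (Real.hasDerivAt_exp t)).sub_const (Real.log (l j).factorial)
  have hpen : HasDerivAt (fun t : ℝ => 1 / 2 * (t * s⁻¹ * t)) (s⁻¹ * t) t := by
    refine ((((hasDerivAt_id t).mul_const s⁻¹).mul (hasDerivAt_id t)).const_mul
      (1 / 2 : ℝ)).congr_deriv ?_
    simp only [id]
    ring
  exact hlik.sub hpen

lemma IsPQLEstimate.score_eq_zero (h : IsPQLEstimate y s β) (i : Fin m) :
    ∑ j, ((y i j : ℝ) - Real.exp (β i)) - s⁻¹ * β i = 0 := by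
  have hmax : IsLocalMax
      (fun t => ∑ j, Real.log (poissonLogLinkDensity t (y i j)) - 1 / 2 * (t * s⁻¹ * t)) (β i) := by
    refine .of_forall fun t => sub_nonpos.1 ?_
    rw [← pqlObjective_update_sub]
    exact sub_nonpos.2 (h (Set.mem_univ (Function.update β i t)))
  exact hmax.hasDerivAt_eq_zero (hasDerivAt_sum_log_poissonLogLinkDensity_sub_penalty (y i) s (β i))

lemma IsPQLEstimate.sqrt_mul_standardizedScore_eq (h : IsPQLEstimate y s β) (i : Fin m) (x : ℝ) :
    √(n : ℝ) * standardizedScore x (y i) =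
      √(n : ℝ) ^ 2 * (Real.exp (β i - x) - 1) + s⁻¹ * Real.exp (-x) * β i := by
  have hsum : √(n : ℝ) * standardizedScore x (y i) =
      (∑ j, (y i j : ℝ)) * Real.exp (-x) - n := by
    rcases n.eq_zero_or_pos with rfl | hn
    · simp
    · rw [standardizedScore, mul_inv_cancel_left₀ (by positivity), Finset.sum_sub_distrib,
        Finset.sum_mul]
      simp
  have hscore := h.score_eq_zero i
  simp only [Finset.sum_sub_distrib, Finset.sum_const, Finset.card_univ, Fintype.card_fin,
    nsmul_eq_mul] at hscore
  rw [hsum, Real.sq_sqrt n.cast_nonneg, sub_eq_add_neg (β i), Real.exp_add]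
  linear_combination Real.exp (-x) * hscore

lemma abs_le_two_mul_of_abs_exp_sub_one_add_mul_le {Δ t ε : ℝ} (ht : 0 ≤ t)
    (h : |Real.exp Δ - 1 + t * Δ| ≤ ε) (hε : ε ≤ 1 / 2) : |Δ| ≤ 2 * ε := by
  obtain ⟨hlower, hupper⟩ := abs_le.1 h
  rcases le_total 0 Δ with hΔ | hΔ
  · rw [abs_of_nonneg hΔ]
    nlinarith [mul_nonneg ht hΔ, Real.add_one_le_exp Δ]
  · have hexp : 1 - ε ≤ Real.exp Δ := by nlinarith [mul_nonneg ht (neg_nonneg.2 hΔ)]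
    have hinv : Real.exp Δ * Real.exp (-Δ) = 1 := by rw [← Real.exp_add]; simp
    have hexp_neg : Real.exp (-Δ) ≤ 1 + 2 * ε := by nlinarith [Real.exp_pos (-Δ)]
    rw [abs_of_nonpos hΔ]
    linarith [Real.add_one_le_exp (-Δ)]

variable {L κ x S Δ C : ℝ}

lemma abs_le_div_of_mul_eq_sq_mul_exp_sub_one_add (hL : 1 ≤ L) (hκ : 0 ≤ κ)
    (hS : |S| ≤ C) (hκx : |κ * x| ≤ C) (hCL : 4 * C ≤ L)
    (h : L * S = L ^ 2 * (Real.exp Δ - 1) + κ * (x + Δ)) :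
    |Δ| ≤ 4 * C / L := by
  have hL0 : 0 < L := one_pos.trans_le hL
  have hperturbed : |Real.exp Δ - 1 + κ / L ^ 2 * Δ| ≤ 2 * C / L := by
    have heq : Real.exp Δ - 1 + κ / L ^ 2 * Δ = (S - κ * x / L) / L := by
      field_simp
      linear_combination -h
    rw [heq, abs_div, abs_of_pos hL0]
    gcongr
    calc |S - κ * x / L| ≤ |S| + |κ * x / L| := abs_sub _ _
      _ ≤ C + C := by
        rw [abs_div, abs_of_pos hL0]
        exact add_le_add hS ((div_le_self (abs_nonneg _) hL).trans hκx)
      _ = 2 * C := by ring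
  refine (abs_le_two_mul_of_abs_exp_sub_one_add_mul_le (by positivity) hperturbed ?_).trans_eq
    (by ring)
  rw [div_le_iff₀ hL0]
  linarith

lemma abs_mul_sub_le_of_mul_eq_sq_mul_exp_sub_one_add (hL : 1 ≤ L) (hκ : 0 ≤ κ)
    (hS : |S| ≤ C) (hκC : κ ≤ C) (hκx : |κ * x| ≤ C) (hCL : 4 * C ≤ L)
    (h : L * S = L ^ 2 * (Real.exp Δ - 1) + κ * (x + Δ)) :
    |L * Δ - S| ≤ (16 * C ^ 2 + 2 * C) / L := by
  have hL0 : 0 < L := one_pos.trans_le hL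
  have hC : 0 ≤ C := hκ.trans hκC
  have hΔ := abs_le_div_of_mul_eq_sq_mul_exp_sub_one_add hL hκ hS hκx hCL h
  have hΔ_one : |Δ| ≤ 1 := hΔ.trans ((div_le_one hL0).2 hCL)
  have hquad : |Real.exp Δ - 1 - Δ| ≤ (4 * C / L) ^ 2 := by
    refine (Real.abs_exp_sub_one_sub_id_le hΔ_one).trans ?_
    rw [← sq_abs]
    gcongr
  have hpenalty : |κ * x + κ * Δ| ≤ 2 * C := by
    calc |κ * x + κ * Δ| ≤ |κ * x| + |κ| * |Δ| := by rw [← abs_mul]; exact abs_add_le _ _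
      _ ≤ C + C * 1 := by
        rw [abs_of_nonneg hκ]
        gcongr
      _ = 2 * C := by ring
  calc |L * Δ - S| = |-(L * (Real.exp Δ - 1 - Δ)) - (κ * x + κ * Δ) / L| := by
        congr 1
        field_simp
        linear_combination -h
    _ ≤ L * |Real.exp Δ - 1 - Δ| + |κ * x + κ * Δ| / L := by
        refine (abs_sub _ _).trans_eq ?_
        rw [abs_neg, abs_mul, abs_div, abs_of_pos hL0]
    _ ≤ L * (4 * C / L) ^ 2 + 2 * C / L := by gcongr
    _ = (16 * C ^ 2 + 2 * C) / L := by
        field_simp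
        ring

end PenalizedQuasiLikelihood

section Expansion

variable {Ω : ℕ → Type*} [∀ k, MeasurableSpace (Ω k)] {P : ∀ k, Measure (Ω k)}
  [∀ k, IsProbabilityMeasure (P k)] {m n : ℕ → ℕ} {v : ℝ≥0}
  {b : ∀ k, Fin (m k) → Ω k → ℝ} {y : ∀ k, Fin (m k) → Fin (n k) → Ω k → ℕ}
  {s : ∀ k, Ω k → ℝ} {bhat : ∀ k, Ω k → Fin (m k) → ℝ}

lemma PoissonRandomIntercept.isBigOpOne_linearization_bound
    (h : ∀ k, PoissonRandomIntercept (P k) (m k) (n k) v (b k) (y k))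
    (hn : Tendsto n atTop atTop) (hs : IsBigOpOne P fun k ω => (s k ω)⁻¹) (i : ∀ k, Fin (m k)) :
    IsBigOpOne P fun k ω =>
      |standardizedScore (b k (i k) ω) fun j => y k (i k) j ω| +
        |(s k ω)⁻¹ * Real.exp (-b k (i k) ω)| +
        |(s k ω)⁻¹ * Real.exp (-b k (i k) ω) * b k (i k) ω| := by
  have hscore := isBigOpOne_of_tendstoInDistribution
    (tendstoInDistribution_standardizedScore h hn i)
  have heffect : IsBigOpOne P fun k ω => b k (i k) ω :=
    isBigOpOne_of_hasLaw fun k => (h k).law_effect (i k)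
  have hexp : IsBigOpOne P fun k ω => Real.exp (-b k (i k) ω) :=
    isBigOpOne_of_hasLaw (ρ := (gaussianReal 0 v).map fun x => Real.exp (-x)) fun k =>
      HasLaw.fun_comp (Y := fun x => Real.exp (-x)) ⟨by fun_prop, rfl⟩ ((h k).law_effect (i k))
  exact (hscore.abs.add (hs.mul hexp).abs).add ((hs.mul hexp).mul heffect).abs

lemma PoissonRandomIntercept.isLittleOpOne_sqrt_mul_gap_sub_standardizedScore
    (h : ∀ k, PoissonRandomIntercept (P k) (m k) (n k) v (b k) (y k))
    (hn : Tendsto n atTop atTop) (hs_pos : ∀ k, ∀ᵐ ω ∂(P k), 0 < s k ω)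
    (hs : IsBigOpOne P fun k ω => (s k ω)⁻¹)
    (hbhat : ∀ k, ∀ᵐ ω ∂(P k), IsPQLEstimate (fun i j => y k i j ω) (s k ω) (bhat k ω))
    (i : ∀ k, Fin (m k)) :
    IsLittleOpOne P fun k ω => √(n k : ℝ) * (bhat k ω (i k) - b k (i k) ω) -
      standardizedScore (b k (i k) ω) fun j => y k (i k) j ω := by
  have hsqrt : Tendsto (fun k => √(n k : ℝ)) atTop atTop :=
    Real.tendsto_sqrt_atTop.comp (tendsto_natCast_atTop_atTop.comp hn)
  refine (isBigOpOne_linearization_bound h hn hs i).isLittleOpOne_of_abs_le fun C =>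
    ⟨fun k => (16 * C ^ 2 + 2 * C) / √(n k : ℝ), hsqrt.const_div_atTop _, ?_⟩
  filter_upwards [hsqrt.eventually_ge_atTop 1, hsqrt.eventually_ge_atTop (4 * C)] with k hone hC
  filter_upwards [hs_pos k, hbhat k] with ω hpos hest hbound
  have hκ : 0 ≤ (s k ω)⁻¹ * Real.exp (-b k (i k) ω) := by positivity
  rw [abs_of_nonneg (a := _ + _) (by positivity), abs_of_nonneg hκ] at hbound
  refine abs_mul_sub_le_of_mul_eq_sq_mul_exp_sub_one_add (x := b k (i k) ω) hone hκ ?_ ?_ ?_ hC ?_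
  any_goals linarith [abs_nonneg (standardizedScore (b k (i k) ω) fun j => y k (i k) j ω),
    abs_nonneg ((s k ω)⁻¹ * Real.exp (-b k (i k) ω) * b k (i k) ω)]
  rw [hest.sqrt_mul_standardizedScore_eq (i k) (b k (i k) ω), add_sub_cancel]

end Expansion

theorem mainTheorem7_general
    {Ω : ℕ → Type*} [∀ k, MeasurableSpace (Ω k)]
    {P : ∀ k, Measure (Ω k)} [∀ k, IsProbabilityMeasure (P k)]
    {m n : ℕ → ℕ} (hn : Tendsto n atTop atTop) {v : ℝ≥0} (hv : 0 < v)
    {b : ∀ k, Fin (m k) → Ω k → ℝ} {y : ∀ k, Fin (m k) → Fin (n k) → Ω k → ℕ}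
    (hmodel : ∀ k, PoissonRandomIntercept (P k) (m k) (n k) v (b k) (y k))
    {s : ∀ k, Ω k → ℝ} (hs_pos : ∀ k, ∀ᵐ ω ∂(P k), 0 < s k ω)
    (hs_bdd : IsBigOpOne P (fun k ω => (s k ω)⁻¹))
    {bhat : ∀ k, Ω k → Fin (m k) → ℝ} (hbhat_meas : ∀ k, AEMeasurable (bhat k) (P k))
    (hbhat : ∀ k, ∀ᵐ ω ∂(P k), IsPQLEstimate (fun i j => y k i j ω) (s k ω) (bhat k ω))
    (i : ∀ k, Fin (m k)) :
    let gap : ∀ k, Ω k → ℝ := fun k ω => bhat k ω (i k) - b k (i k) ω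
    let S : ∀ k, Ω k → ℝ := fun k ω =>
      standardizedScore (b k (i k) ω) fun j => y k (i k) j ω
    IsLittleOpOne P (fun k ω => √(n k : ℝ) * gap k ω - S k ω) ∧
      ¬ IsAsymptoticallyNormal P S ∧
      ¬ IsAsymptoticallyNormal P gap := by
  intro gap S
  have hexpansion : IsLittleOpOne P fun k ω => √(n k : ℝ) * gap k ω - S k ω :=
    PoissonRandomIntercept.isLittleOpOne_sqrt_mul_gap_sub_standardizedScore hmodel hn hs_pos
      hs_bdd hbhat i
  have hS := PoissonRandomIntercept.tendstoInDistribution_standardizedScore hmodel hn i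
  have hgap_meas (k : ℕ) : AEMeasurable (gap k) (P k) :=
    (aemeasurable_pi_iff.1 (hbhat_meas k) (i k)).sub
      ((hmodel k).measurable_effect (i k)).aemeasurable
  have hgap := tendstoInDistribution_of_isLittleOpOne_sub hS
    (fun k => (hgap_meas k).const_mul √(n k : ℝ)) hexpansion
  have hsqrt_ne : ∀ᶠ k in atTop, √(n k : ℝ) ≠ 0 :=
    (hn.eventually_gt_atTop 0).mono fun k hk => by positivity
  exact ⟨hexpansion,
    not_isAsymptoticallyNormal_of_tendstoInDistribution_lognormal_mixture hv.ne' hS,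
    fun hnormal => not_isAsymptoticallyNormal_of_tendstoInDistribution_lognormal_mixture hv.ne'
      hgap (hnormal.const_mul hsqrt_ne hgap_meas)⟩

theorem mainTheorem7
    (Ω : ℕ → Type*) [∀ k, MeasurableSpace (Ω k)]
    (P : ∀ k, Measure (Ω k)) [∀ k, IsProbabilityMeasure (P k)]
    -- numbers of clusters and common cluster sizes
    (m n : ℕ → ℕ) (hm_pos : ∀ k, 0 < m k)
    (hm : Tendsto m atTop atTop) (hn : Tendsto n atTop atTop)
    (hmn : Tendsto (fun k => (m k : ℝ) / (n k : ℝ) ^ 2) atTop (𝓝 0))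
    -- the data: true random effects and responses
    (v : ℝ≥0) (hv : 0 < v)
    (b : ∀ k, Fin (m k) → Ω k → ℝ) (y : ∀ k, Fin (m k) → Fin (n k) → Ω k → ℕ)
    (hmodel : ∀ k, PoissonRandomIntercept (P k) (m k) (n k) v (b k) (y k))
    -- the working variance, possibly stochastic, with stochastically bounded inverse
    (s : ∀ k, Ω k → ℝ) (hs_meas : ∀ k, AEMeasurable (s k) (P k))
    (hs_pos : ∀ k, ∀ᵐ ω ∂(P k), 0 < s k ω)
    (hs_bdd : IsBigOpOne P (fun k ω => (s k ω)⁻¹))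
    -- the PQL estimator of the random effects
    (bhat : ∀ k, Ω k → Fin (m k) → ℝ) (hbhat_meas : ∀ k, AEMeasurable (bhat k) (P k))
    (hbhat : ∀ k, ∀ᵐ ω ∂(P k), IsPQLEstimate (fun i j => y k i j ω) (s k ω) (bhat k ω)) :
    -- the first cluster
    let i₁ : ∀ k, Fin (m k) := fun k => ⟨0, hm_pos k⟩
    -- the prediction gap of the first cluster
    let gap : ∀ k, Ω k → ℝ := fun k ω => bhat k ω (i₁ k) - b k (i₁ k) ω
    -- the leading term `n^{-1/2} ∑ j, (y_{1j} exp(-b_1) - 1)`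
    let S : ∀ k, Ω k → ℝ := fun k ω =>
      (√(n k : ℝ))⁻¹ * ∑ j, ((y k (i₁ k) j ω : ℝ) * Real.exp (-(b k (i₁ k) ω)) - 1)
    IsLittleOpOne P (fun k ω => √(n k : ℝ) * gap k ω - S k ω) ∧
      ¬ IsAsymptoticallyNormal P S ∧
      ¬ IsAsymptoticallyNormal P gap :=
  mainTheorem7_general hn hv hmodel hs_pos hs_bdd hbhat_meas hbhat fun k => ⟨0, hm_pos k⟩
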